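/- Theorem. Alice holds a string $x\in\{0,1\}^n$ and Bob holds a string $y\in\{0,1\}^n$. In the disjointness problem they must decide whether there exists an $i$ with $x_i=y_i=1$. The quantum communication complexity of the disjointness problem is $O(\sqrt n)$: there is a constant $C>0$ such that for every $n\ge 1$ there is a quantum communication protocol in which at most $C\sqrt n$ qubits in total are sent between the parties and which, for every pair of inputs $(x,y)$, ends with both parties outputting the correct answer with probability at least $2/3$. Here a protocol uses no prior entanglement and no shared randomness. Alice and Bob each have a private finite-dimensional register, and they share a one-qubit channel; the joint system starts in a fixed product basis state independent of the inputs. Starting with Alice, the parties alternate: the party holding the channel qubit applies a unitary, depending only on the time step and that party's own input, to his or her register and the channel qubit, and then sends the qubit to the other party. The party holding the qubit after the last transmission may apply one further such unitary; finally each party measures his or her own register and outputs a bit. The cost is the number of transmissions of the qubit, and the quantum communication complexity is the least cost of a protocol that is correct with probability at least $2/3$ on every input. -/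

import Mathlib

open scoped ENNReal

/-- A two-party quantum communication protocol (without prior entanglement or shared
randomness) for inputs `x : X` of Alice and `y : Y` of Bob.  Alice has a private register with
computational basis `A`, Bob one with computational basis `B`, and there is a one-qubit channel
with computational basis `Bool`.  At time `t` the party holding the channel qubit (Alice if `t` is
even, Bob if `t` is odd) applies a unitary, depending only on that party's own input and on `t`,
to his or her own register together with the channel qubit, and the qubit is then sent to the
other party.  `cost` is the number of times the qubit is sent, that is, the total number of
qubits communicated in both directions; the holder after the last transmission acts once more.
In the end both parties measure their own registers and output a bit. -/
structure QuantumProtocol (X Y : Type*) where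
  A : Type
  B : Type
  [fintypeA : Fintype A]
  [fintypeB : Fintype B]
  [decEqA : DecidableEq A]
  [decEqB : DecidableEq B]
  initA : A
  initB : B
  opA : ℕ → X → Matrix.unitaryGroup (A × Bool) ℂ
  opB : ℕ → Y → Matrix.unitaryGroup (Bool × B) ℂ
  outA : A → Bool
  outB : B → Bool
  cost : ℕ

namespace QuantumProtocol

variable {X Y : Type*}

attribute [instance] fintypeA fintypeB decEqA decEqB

/-- Pure states of the joint system (Alice's register, channel qubit, Bob's register), given by
their amplitudes in the computational basis. -/
abbrev State (P : QuantumProtocol X Y) : Type := P.A × Bool × P.B → ℂ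

/-- `U ⊗ 1`: a matrix on Alice's register and the channel applied to a joint state. -/
noncomputable def applyA (P : QuantumProtocol X Y)
    (U : Matrix (P.A × Bool) (P.A × Bool) ℂ) (ψ : P.State) : P.State :=
  fun s => ∑ r : P.A × Bool, U (s.1, s.2.1) r * ψ (r.1, r.2, s.2.2)

/-- `1 ⊗ V`: a matrix on the channel and Bob's register applied to a joint state. -/
noncomputable def applyB (P : QuantumProtocol X Y)
    (V : Matrix (Bool × P.B) (Bool × P.B) ℂ) (ψ : P.State) : P.State :=
  fun s => ∑ r : Bool × P.B, V (s.2.1, s.2.2) r * ψ (s.1, r.1, r.2)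

/-- The joint state before the local operation of time `t`. -/
noncomputable def state (P : QuantumProtocol X Y) (x : X) (y : Y) : ℕ → P.State
  | 0 => Pi.single (P.initA, false, P.initB) 1
  | t + 1 =>
    if Even t then P.applyA (P.opA t x) (P.state x y t)
    else P.applyB (P.opB t y) (P.state x y t)

/-- The joint state at the end: `cost` transmissions separate `cost + 1` local operations. -/
noncomputable def finalState (P : QuantumProtocol X Y) (x : X) (y : Y) : P.State :=
  P.state x y (P.cost + 1)

/-- The probability that, on inputs `x` and `y`, Alice and Bob both output the bit `v`. -/
noncomputable def probOutput (P : QuantumProtocol X Y) (x : X) (y : Y) (v : Bool) : ℝ :=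
  ∑ s : P.A × Bool × P.B,
    if P.outA s.1 = v ∧ P.outB s.2.2 = v then ‖P.finalState x y s‖ ^ 2 else 0

/-- The protocol computes `f` with two-sided error at most `1/3` on every input. -/
def Computes (P : QuantumProtocol X Y) (f : X → Y → Bool) : Prop :=
  ∀ x y, 2 / 3 ≤ P.probOutput x y (f x y)

end QuantumProtocol

/-- The (two-sided, bounded-error) quantum communication complexity of `f`: the least number of
qubits communicated by a protocol that computes `f` (`⊤` if there is none). -/
noncomputable def quantumCommComplexity {X Y : Type*} (f : X → Y → Bool) : ℕ∞ :=
  ⨅ (P : QuantumProtocol X Y) (_ : P.Computes f), (P.cost : ℕ∞)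

/-- The disjointness problem: decide whether there is an `i` with `x i = y i = 1`. -/
def disjointness (n : ℕ) (x y : Fin n → Bool) : Bool :=
  decide (∃ i, x i = true ∧ y i = true)

/-! The protocol is a distributed quantum walk on a binary tree whose leaves are the coordinates. An
edge is named by its lower vertex, with an extra edge above the root. The walk `U` composes the
reflection at the stars of even depth, a sign flip at the leaves where both strings have a one, and
the reflection at the stars of odd depth. Let `e` be the basis vector of the root edge and `p` the
average of `U ^ j e` over `j < M`; the squared norm of `p` decides the problem.

Without a common one, the vector `z` of square roots of the edge weights satisfies `2 e = z - U z`.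
The average telescopes, so `‖p‖ ≤ ‖z‖ / M`, where `‖z‖²` is the total weight, at most `1 + 32 n`
(`two_smul_root_eq`, `normSum_amplitude_le`). With a common one, the unit flow from the root to that
leaf, with signs alternating by depth and divided by the amplitudes, is fixed by `U` and has overlap
one with `e`. Its squared norm is the resistance of the path, at most `3 / 2`, so `‖p‖² ≥ 2 / 3` by
Cauchy–Schwarz (`walk_potential`, `normSum_potential_le`). Weights proportional to `√(2 n) / √v`
keep the total weight linear and the resistance bounded, so `M` of order `√n` suffices.

Each application of `U` costs a bounded number of qubits. Both parties hold a copy of the current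
vertex. Alice may mix the edges of a star only if Bob's copy does not tell them apart; so Bob first
moves his copy to the centre of the star, guided by two one-bit messages, and afterwards moves it
back (`reaches_halfRound`). The sign flip takes one message. A counter in uniform superposition,
held by Alice, controls how many times `U` acts; returning it to its initial basis state has
amplitude vector `p` (`exists_reaches_allSteps`). -/

/-! ### Unitary matrices and norms. -/

/-- A matrix obtained from a unitary one by permuting rows and columns is unitary. -/
theorem submatrix_equiv_mem_unitaryGroup {m l : Type*} [Fintype m] [DecidableEq m] [Fintype l]
    [DecidableEq l] {U : Matrix m m ℂ} (hU : U ∈ Matrix.unitaryGroup m ℂ) (e f : l ≃ m) :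
    U.submatrix e f ∈ Matrix.unitaryGroup l ℂ := by
  rw [Matrix.mem_unitaryGroup_iff] at hU ⊢
  rw [Matrix.star_eq_conjTranspose, Matrix.conjTranspose_submatrix, Matrix.submatrix_mul_equiv,
    ← Matrix.star_eq_conjTranspose, hU, Matrix.submatrix_one_equiv]

/-- A block diagonal matrix with unitary blocks is unitary. -/
theorem blockDiagonal_mem_unitaryGroup {m o : Type*} [Fintype m] [DecidableEq m] [Fintype o]
    [DecidableEq o] {U : o → Matrix m m ℂ} (hU : ∀ k, U k ∈ Matrix.unitaryGroup m ℂ) :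
    Matrix.blockDiagonal U ∈ Matrix.unitaryGroup (m × o) ℂ := by
  rw [Matrix.mem_unitaryGroup_iff, Matrix.star_eq_conjTranspose,
    Matrix.blockDiagonal_conjTranspose, ← Matrix.blockDiagonal_mul, ← Matrix.blockDiagonal_one]
  congr 1
  funext k
  exact Matrix.mem_unitaryGroup_iff.1 (hU k)

theorem blockDiagonal_mulVec {m o : Type*} [Fintype m] [Fintype o] [DecidableEq o]
    (M : o → Matrix m m ℂ) (α : m × o → ℂ) (v : m) (k : o) :
    (Matrix.blockDiagonal M).mulVec α (v, k) = (M k).mulVec (fun w => α (w, k)) v := by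
  simp only [Matrix.mulVec, dotProduct, Fintype.sum_prod_type, Matrix.blockDiagonal_apply]
  refine Finset.sum_congr rfl fun w _ => ?_
  rw [Finset.sum_eq_single k] <;> simp +contextual [eq_comm]

/-- The sum of the squared absolute values of the entries of a vector. -/
noncomputable def normSum {ι : Type*} [Fintype ι] (α : ι → ℂ) : ℝ := ∑ i, ‖α i‖ ^ 2

theorem normSum_eq_norm_sq {ι : Type*} [Fintype ι] (α : ι → ℂ) :
    normSum α = ‖WithLp.toLp 2 α‖ ^ 2 := by
  rw [EuclideanSpace.norm_sq_eq]; rfl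

theorem normSum_eq_dotProduct {ι : Type*} [Fintype ι] (α : ι → ℂ) :
    ((normSum α : ℝ) : ℂ) = dotProduct (star α) α := by
  simp [normSum, dotProduct, Complex.conj_mul']

theorem normSum_mulVec {ι : Type*} [Fintype ι] [DecidableEq ι] {U : Matrix ι ι ℂ}
    (hU : U ∈ Matrix.unitaryGroup ι ℂ) (α : ι → ℂ) : normSum (U.mulVec α) = normSum α := by
  have h : ((normSum (U.mulVec α) : ℝ) : ℂ) = (normSum α : ℝ) := by
    rw [normSum_eq_dotProduct, normSum_eq_dotProduct, Matrix.star_mulVec,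
      ← Matrix.dotProduct_mulVec, Matrix.mulVec_mulVec, ← Matrix.star_eq_conjTranspose,
      Matrix.mem_unitaryGroup_iff'.1 hU, Matrix.one_mulVec]
  exact_mod_cast h

/-! ### Protocols in which Bob's register is a function of Alice's. -/

/-- One step of a protocol driven by Alice: she applies the unitary `W x` to her register and
sends the bit `g x a` computed from its content `a`; if the bit is set, Bob applies the signed
permutation with permutation `σ` and signs `flip y`; then the bit is returned and erased. -/
structure DrivenStep (X Y A B : Type) [Fintype A] [DecidableEq A] where
  W : X → Matrix.unitaryGroup A ℂ
  g : X → A → Bool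
  σ : Equiv.Perm B
  flip : Y → B → Bool

namespace DrivenStep

variable {X Y A B : Type} [Fintype A] [DecidableEq A] [Fintype B] [DecidableEq B]

/-- The trivial step. -/
def idle : DrivenStep X Y A B := ⟨fun _ => 1, fun _ _ => false, 1, fun _ _ => false⟩

/-- The involution adding `g a` to the channel bit. -/
def xorEquiv (g : A → Bool) : A × Bool ≃ A × Bool :=
  Function.Involutive.toPerm (fun r => (r.1, xor r.2 (g r.1))) fun r => by simp

/-- Alice erases the bit `g₀` from the channel, applies `W` and writes the bit `g₁`. -/
noncomputable def aliceOp (g₀ g₁ : A → Bool) (W : Matrix.unitaryGroup A ℂ) :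
    Matrix.unitaryGroup (A × Bool) ℂ :=
  ⟨_, submatrix_equiv_mem_unitaryGroup
    (blockDiagonal_mem_unitaryGroup (o := Bool) fun _ => W.2) (xorEquiv g₁) (xorEquiv g₀)⟩

/-- The signed permutation matrix with permutation `σ` and signs given by `s`. -/
noncomputable def signedPerm (σ : Equiv.Perm B) (s : B → Bool) : Matrix B B ℂ :=
  (Matrix.diagonal fun b => if s b then (-1 : ℂ) else 1).submatrix σ.symm (Equiv.refl B)

theorem signedPerm_mem (σ : Equiv.Perm B) (s : B → Bool) :
    signedPerm σ s ∈ Matrix.unitaryGroup B ℂ := by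
  refine submatrix_equiv_mem_unitaryGroup ?_ _ _
  rw [Matrix.mem_unitaryGroup_iff, Matrix.star_eq_conjTranspose, Matrix.diagonal_conjTranspose,
    Matrix.diagonal_mul_diagonal, ← Matrix.diagonal_one]
  congr 1
  funext b
  by_cases h : s b = true <;> simp [h]

theorem signedPerm_apply (σ : Equiv.Perm B) (s : B → Bool) (b b' : B) :
    signedPerm σ s b b' = if b = σ b' then (if s b' then (-1 : ℂ) else 1) else 0 := by
  simp only [signedPerm, Matrix.submatrix_apply, Matrix.diagonal_apply, Equiv.refl_apply,
    Equiv.symm_apply_eq]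
  by_cases h : b = σ b' <;> simp [h]

/-- Bob applies a signed permutation if the channel bit is set. -/
noncomputable def bobOp (σ : Equiv.Perm B) (s : B → Bool) : Matrix.unitaryGroup (Bool × B) ℂ :=
  ⟨_, submatrix_equiv_mem_unitaryGroup
    (blockDiagonal_mem_unitaryGroup (U := fun c : Bool => if c then signedPerm σ s else 1)
      fun c => by cases c <;> simp [signedPerm_mem, one_mem])
    (Equiv.prodComm Bool B) (Equiv.prodComm Bool B)⟩

/-- The bit that is still on the channel before step `k` of the list `l`. -/
def pending (l : List (DrivenStep X Y A B)) (x : X) (k : ℕ) : A → Bool :=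
  if k = 0 then fun _ => false else (l.getD (k - 1) idle).g x

/-- The protocol that executes a list of steps driven by Alice. -/
noncomputable def toProtocol (l : List (DrivenStep X Y A B)) (a₀ : A) (b₀ : B) (outA : A → Bool)
    (outB : B → Bool) : QuantumProtocol X Y where
  A := A
  B := B
  initA := a₀
  initB := b₀
  opA t x := aliceOp (pending l x (t / 2)) ((l.getD (t / 2) idle).g x) ((l.getD (t / 2) idle).W x)
  opB t y := bobOp (l.getD (t / 2) idle).σ ((l.getD (t / 2) idle).flip y)
  outA := outA
  outB := outB
  cost := 2 * l.length - 1

/-- `Reaches x y a₀ b₀ l h α`: on inputs `x` and `y`, the steps `l` lead from the basis state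
`a₀, b₀` to the state in which Alice's register is in state `α` and Bob's holds the copy `h a` of
its content `a`. -/
inductive Reaches (x : X) (y : Y) (a₀ : A) (b₀ : B) :
    List (DrivenStep X Y A B) → (A → B) → (A → ℂ) → Prop
  | nil (h : A → B) (h₀ : h a₀ = b₀) : Reaches x y a₀ b₀ [] h (Pi.single a₀ 1)
  | snoc {l h α} (s : DrivenStep X Y A B) (hl : Reaches x y a₀ b₀ l h α)
      (hW : ∀ a a', (s.W x : Matrix A A ℂ) a a' ≠ 0 → h a = h a') {h' α'}
      (hh : ∀ a, h' a = if s.g x a then s.σ (h a) else h a)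
      (hα : ∀ a, α' a = (if s.g x a && s.flip y (h a) then -1 else 1) *
        (s.W x : Matrix A A ℂ).mulVec α a) :
      Reaches x y a₀ b₀ (l ++ [s]) h' α'

theorem Reaches.normSum_eq {x : X} {y : Y} {a₀ : A} {b₀ : B} {l : List (DrivenStep X Y A B)}
    {h : A → B} {α : A → ℂ} (H : Reaches x y a₀ b₀ l h α) : normSum α = 1 := by
  induction H with
  | nil h h₀ =>
    rw [normSum, Finset.sum_eq_single a₀] <;> simp +contextual
  | @snoc l h α s hl hW h' α' hh hα ih =>
    rw [← ih, ← normSum_mulVec (s.W x).2 α]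
    refine Finset.sum_congr rfl fun a _ => ?_
    rw [hα, norm_mul]
    split_ifs <;> simp

/-- The joint state before step `k` of the protocol given by a list of steps. -/
noncomputable def jointState (l : List (DrivenStep X Y A B)) (x : X) (y : Y) (a₀ : A) (b₀ : B) :
    ℕ → A × Bool × B → ℂ
  | 0 => Pi.single (a₀, false, b₀) 1
  | k + 1 => fun s => ∑ r : Bool × B,
      (bobOp (l.getD k idle).σ ((l.getD k idle).flip y) : Matrix (Bool × B) (Bool × B) ℂ)
        (s.2.1, s.2.2) r *
      ∑ q : A × Bool, (aliceOp (pending l x k) ((l.getD k idle).g x) ((l.getD k idle).W x) :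
        Matrix (A × Bool) (A × Bool) ℂ) (s.1, r.1) q * jointState l x y a₀ b₀ k (q.1, q.2, r.2)

theorem toProtocol_state (l : List (DrivenStep X Y A B)) (x : X) (y : Y) (a₀ : A) (b₀ : B)
    (outA : A → Bool) (outB : B → Bool) (k : ℕ) :
    (toProtocol l a₀ b₀ outA outB).state x y (2 * k) = jointState l x y a₀ b₀ k := by
  induction k with
  | zero => rfl
  | succ k ih =>
    rw [show 2 * (k + 1) = 2 * k + 1 + 1 by ring, QuantumProtocol.state,
      if_neg (by simp), QuantumProtocol.state, if_pos (even_two_mul _), ih]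
    have h1 : (toProtocol l a₀ b₀ outA outB).opA (2 * k) x =
        aliceOp (pending l x k) ((l.getD k idle).g x) ((l.getD k idle).W x) := by
      change aliceOp (pending l x (2 * k / 2)) ((l.getD (2 * k / 2) idle).g x)
        ((l.getD (2 * k / 2) idle).W x) = _
      rw [Nat.mul_div_cancel_left _ two_pos]
    have h2 : (toProtocol l a₀ b₀ outA outB).opB (2 * k + 1) y =
        bobOp (l.getD k idle).σ ((l.getD k idle).flip y) := by
      change bobOp (l.getD ((2 * k + 1) / 2) idle).σ ((l.getD ((2 * k + 1) / 2) idle).flip y) = _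
      rw [show (2 * k + 1) / 2 = k by omega]
    rw [h1, h2]
    rfl

theorem aliceOp_apply (g₀ g₁ : A → Bool) (W : Matrix.unitaryGroup A ℂ) (a a' : A) (c c' : Bool) :
    (aliceOp g₀ g₁ W : Matrix (A × Bool) (A × Bool) ℂ) (a, c) (a', c') =
      if c' = xor (xor c (g₁ a)) (g₀ a') then (W : Matrix A A ℂ) a a' else 0 := by
  have hx : ∀ (g : A → Bool) r, xorEquiv g r = (r.1, xor r.2 (g r.1)) := fun _ _ => rfl
  simp only [aliceOp, Matrix.submatrix_apply, hx, Matrix.blockDiagonal_apply]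
  congr 1
  cases c <;> cases c' <;> cases g₁ a <;> cases g₀ a' <;> simp

theorem bobOp_apply (σ : Equiv.Perm B) (s : B → Bool) (b b' : B) (c c' : Bool) :
    (bobOp σ s : Matrix (Bool × B) (Bool × B) ℂ) (c, b) (c', b') =
      if c = c' ∧ b = (if c then σ b' else b') then (if c && s b' then (-1 : ℂ) else 1) else 0 := by
  simp only [bobOp, Matrix.submatrix_apply, Equiv.prodComm_apply, Prod.swap_prod_mk,
    Matrix.blockDiagonal_apply]
  cases c <;> cases c' <;> simp [signedPerm_apply, Matrix.one_apply]

/-- Both the channel bit and Bob's register are functions of Alice's content, so a single vector on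
`A` describes the joint state. The tail `l'` is arbitrary because the induction removes steps from
the end, while the protocol is built from the whole list. -/
theorem Reaches.jointState_eq {x : X} {y : Y} {a₀ : A} {b₀ : B} {l : List (DrivenStep X Y A B)}
    {h : A → B} {α : A → ℂ} (H : Reaches x y a₀ b₀ l h α) (l' : List (DrivenStep X Y A B))
    (a : A) (c : Bool) (b : B) :
    jointState (l ++ l') x y a₀ b₀ l.length (a, c, b) =
      if c = pending (l ++ l') x l.length a ∧ b = h a then α a else 0 := by
  induction H generalizing l' a c b with
  | nil h h₀ =>
    simp only [List.length_nil, jointState, Pi.single_apply, pending, if_true, Prod.mk.injEq]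
    by_cases ha : a = a₀
    · subst ha; simp [h₀]
    · simp [ha]
  | @snoc l h α s hl hW h' α' hh hα ih =>
    have ih := ih (s :: l')
    rw [show l ++ [s] ++ l' = l ++ s :: l' by simp]
    have hget : (l ++ s :: l').getD l.length idle = s := by simp
    have hpend : pending (l ++ s :: l') x (l ++ [s]).length = s.g x := by
      simp [pending]
    rw [hpend, show (l ++ [s]).length = l.length + 1 by simp, jointState, hget]
    have h1 : ∀ (c : Bool) (b : B), ∑ q : A × Bool,
        (aliceOp (pending (l ++ s :: l') x l.length) (s.g x) (s.W x) :
          Matrix (A × Bool) (A × Bool) ℂ) (a, c) q *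
          jointState (l ++ s :: l') x y a₀ b₀ l.length (q.1, q.2, b) =
        if c = s.g x a ∧ b = h a then (s.W x : Matrix A A ℂ).mulVec α a else 0 := by
      intro c b
      simp only [Fintype.sum_prod_type, ih, aliceOp_apply]
      have : ∀ a' : A, ∑ c' : Bool,
          (if c' = xor (xor c (s.g x a)) (pending (l ++ s :: l') x l.length a') then
            (s.W x : Matrix A A ℂ) a a' else 0) *
          (if c' = pending (l ++ s :: l') x l.length a' ∧ b = h a' then α a' else 0) =
          if c = s.g x a ∧ b = h a then (s.W x : Matrix A A ℂ) a a' * α a' else 0 := by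
        intro a'
        by_cases h0 : (s.W x : Matrix A A ℂ) a a' = 0
        · simp [h0]
        -- `W` mixes only contents with the same copy at Bob's side, so the condition on `b` does
        -- not depend on `a'` and leaves the sum.
        · rw [hW a a' h0]
          cases c <;> cases s.g x a <;> cases pending (l ++ s :: l') x l.length a' <;> simp
      simp only [this]
      split_ifs
      · rfl
      · simp
    simp only [h1, Fintype.sum_prod_type, bobOp_apply]
    rw [Finset.sum_eq_single c (by intro c' _ hc; simp [hc.symm]) (by simp),
      Finset.sum_eq_single (h a) (by intro b' _ hb; simp [hb]) (by simp), hh, hα]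
    by_cases hc : c = s.g x a
    · subst hc
      by_cases hb : b = if s.g x a = true then s.σ (h a) else h a
      · simp [hb]
      · simp [hb]
    · simp [hc]

/-- The probability that both parties output `v`, when Bob's output bit agrees with Alice's. -/
theorem Reaches.probOutput_eq {x : X} {y : Y} {a₀ : A} {b₀ : B} {l : List (DrivenStep X Y A B)}
    {h : A → B} {α : A → ℂ} (H : Reaches x y a₀ b₀ l h α) (hl : l ≠ [])
    {outA : A → Bool} {outB : B → Bool} (hout : ∀ a, outB (h a) = outA a) (v : Bool) :
    (toProtocol l a₀ b₀ outA outB).probOutput x y v =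
      ∑ a, if outA a = v then ‖α a‖ ^ 2 else 0 := by
  have hlen : 0 < l.length := List.length_pos_iff.2 hl
  have hfin : (toProtocol l a₀ b₀ outA outB).finalState x y = jointState l x y a₀ b₀ l.length := by
    rw [← toProtocol_state l x y a₀ b₀ outA outB]
    change (toProtocol l a₀ b₀ outA outB).state x y (2 * l.length - 1 + 1) = _
    -- Each step has two local operations, and the last one, by Bob, follows the last transmission;
    -- hence the `- 1` in the cost.
    rw [Nat.sub_add_cancel (by omega)]
  rw [QuantumProtocol.probOutput, hfin]
  change ∑ s : A × Bool × B, (if outA s.1 = v ∧ outB s.2.2 = v then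
    ‖jointState l x y a₀ b₀ l.length s‖ ^ 2 else 0) = _
  have hj := H.jointState_eq []
  rw [List.append_nil] at hj
  simp only [Fintype.sum_prod_type, hj]
  refine Finset.sum_congr rfl fun a _ => ?_
  rw [Finset.sum_eq_single (pending l x l.length a) (by intro c _ hc; simp [hc]) (by simp),
    Finset.sum_eq_single (h a) (by intro b _ hb; simp [hb]) (by simp), hout]
  simp

end DrivenStep

/-! ### Reflections in the fibers of a map. -/

section FiberReflection

variable {ι κ : Type*} [Fintype ι] [DecidableEq ι] [DecidableEq κ]

/-- The sum of the squares of `s` over the fiber of `f` above `u`. -/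
noncomputable def fiberWeight (f : ι → κ) (s : ι → ℝ) (u : κ) : ℝ :=
  ∑ i, if f i = u then s i ^ 2 else 0

/-- The orthogonal projection onto the span of the restrictions of `s` to the fibers of `f` above
the elements of `S`. -/
noncomputable def fiberProjection (f : ι → κ) (s : ι → ℝ) (S : κ → Bool) : Matrix ι ι ℂ :=
  fun i j => if f i = f j ∧ S (f i) then ((s i * s j / fiberWeight f s (f i) : ℝ) : ℂ) else 0

/-- The reflection with `-1`-eigenspace spanned by the restrictions of `s` to the fibers of `f`
above the elements of `S`. -/
noncomputable def fiberReflection (f : ι → κ) (s : ι → ℝ) (S : κ → Bool) : Matrix ι ι ℂ :=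
  1 - (2 : ℂ) • fiberProjection f s S

theorem fiberProjection_isHermitian (f : ι → κ) (s : ι → ℝ) (S : κ → Bool) :
    (fiberProjection f s S).IsHermitian := by
  ext i j
  simp only [Matrix.conjTranspose_apply, fiberProjection]
  by_cases h : f i = f j
  · by_cases h' : S (f j) = true <;> simp [h, h', mul_comm]
  · simp [h, Ne.symm h]

theorem fiberProjection_mul_self (f : ι → κ) (s : ι → ℝ) (S : κ → Bool) :
    fiberProjection f s S * fiberProjection f s S = fiberProjection f s S := by
  ext i j
  rw [Matrix.mul_apply]
  by_cases h : f i = f j ∧ S (f i)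
  · have hk : ∀ k, fiberProjection f s S i k * fiberProjection f s S k j =
        ((s i * s j / fiberWeight f s (f i) ^ 2 * (if f k = f i then s k ^ 2 else 0) : ℝ) : ℂ) := by
      intro k
      by_cases hk : f k = f i
      · simp only [fiberProjection, hk, h.1.symm, h.2, true_and, if_true]
        push_cast
        ring
      · simp [fiberProjection, hk, Ne.symm hk]
    simp only [hk]
    rw [← Complex.ofReal_sum, ← Finset.mul_sum]
    change ((s i * s j / fiberWeight f s (f i) ^ 2 * fiberWeight f s (f i) : ℝ) : ℂ) = _
    rw [fiberProjection, if_pos h]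
    congr 1
    -- On a fiber of weight zero, division by zero makes both sides vanish.
    by_cases h0 : fiberWeight f s (f i) = 0
    · simp [h0]
    · field_simp
  · rw [Finset.sum_eq_zero, fiberProjection, if_neg h]
    intro k _
    by_contra hne
    apply h
    obtain ⟨h1, h2⟩ := mul_ne_zero_iff.1 hne
    have h1 := (ite_ne_right_iff.1 h1).1
    have h2 := (ite_ne_right_iff.1 h2).1
    exact ⟨h1.1.trans h2.1, h1.2⟩

theorem fiberReflection_mul_self (f : ι → κ) (s : ι → ℝ) (S : κ → Bool) :
    fiberReflection f s S * fiberReflection f s S = 1 := by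
  have := fiberProjection_mul_self f s S
  simp only [fiberReflection, sub_mul, mul_sub, one_mul, mul_one, smul_mul_assoc, mul_smul_comm,
    this]
  module

theorem fiberReflection_mem (f : ι → κ) (s : ι → ℝ) (S : κ → Bool) :
    fiberReflection f s S ∈ Matrix.unitaryGroup ι ℂ := by
  rw [Matrix.mem_unitaryGroup_iff]
  have h : star (fiberReflection f s S) = fiberReflection f s S := by
    rw [Matrix.star_eq_conjTranspose, fiberReflection, Matrix.conjTranspose_sub,
      Matrix.conjTranspose_smul, (fiberProjection_isHermitian f s S).eq]
    simp
  rw [h, fiberReflection_mul_self]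

theorem fiberReflection_ne_zero {f : ι → κ} {s : ι → ℝ} {S : κ → Bool} {i j : ι}
    (h : fiberReflection f s S i j ≠ 0) : f i = f j := by
  by_contra hne
  have hij : i ≠ j := fun h => hne (congrArg f h)
  simp [fiberReflection, fiberProjection, hne, hij] at h

theorem fiberReflection_mulVec (f : ι → κ) (s : ι → ℝ) (S : κ → Bool) (α : ι → ℝ) (i : ι) :
    (fiberReflection f s S).mulVec (fun j => (α j : ℂ)) i =
      ((α i - 2 * (if S (f i) then s i / fiberWeight f s (f i) *
        ∑ j, (if f j = f i then s j * α j else 0) else 0) : ℝ) : ℂ) := by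
  have key : (fiberProjection f s S).mulVec (fun j => (α j : ℂ)) i =
      ((if S (f i) then s i / fiberWeight f s (f i) *
        ∑ j, (if f j = f i then s j * α j else 0) else 0 : ℝ) : ℂ) := by
    by_cases h : S (f i) = true
    · rw [if_pos h, Finset.mul_sum, Complex.ofReal_sum]
      refine Finset.sum_congr rfl fun j _ => ?_
      change fiberProjection f s S i j * (α j : ℂ) = _
      by_cases hj : f i = f j
      · rw [fiberProjection, if_pos ⟨hj, h⟩, if_pos hj.symm]
        push_cast
        ring
      · simp [fiberProjection, hj, Ne.symm hj]
    · simp [Matrix.mulVec, dotProduct, fiberProjection, h]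
  rw [fiberReflection, Matrix.sub_mulVec, Matrix.one_mulVec, Matrix.smul_mulVec, Pi.sub_apply,
    Pi.smul_apply, key, smul_eq_mul, Complex.ofReal_sub, Complex.ofReal_mul, Complex.ofReal_ofNat]

theorem fiberReflection_mulVec_self (f : ι → κ) (s : ι → ℝ) (S : κ → Bool) (i : ι) :
    (fiberReflection f s S).mulVec (fun j => (s j : ℂ)) i =
      ((if S (f i) then -s i else s i : ℝ) : ℂ) := by
  rw [fiberReflection_mulVec]
  congr 1
  have hN : ∑ j, (if f j = f i then s j * s j else 0) = fiberWeight f s (f i) := by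
    simp only [fiberWeight, sq]
  rw [hN]
  by_cases h : S (f i) = true
  · rw [if_pos h, if_pos h]
    by_cases h0 : fiberWeight f s (f i) = 0
    · have := (Finset.sum_eq_zero_iff_of_nonneg (fun j _ => by positivity)).1 h0 i
        (Finset.mem_univ i)
      have hs : s i = 0 := by simpa using this
      simp [hs]
    · field_simp
      ring
  · rw [if_neg h, if_neg h]
    ring

end FiberReflection

/-! ### Preparing the uniform superposition of the counter. -/

section UniformReflection

variable {J : Type*} [Fintype J] [DecidableEq J]

/-- A reflection exchanging the basis vector of `j₀` and the uniform unit vector. -/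
noncomputable def uniformReflection (j₀ : J) : Matrix J J ℂ :=
  fiberReflection (fun _ => ()) (fun j => (if j = j₀ then 1 else 0) - 1 / √(Fintype.card J))
    (fun _ => true)

theorem uniformReflection_mem (j₀ : J) : uniformReflection j₀ ∈ Matrix.unitaryGroup J ℂ :=
  fiberReflection_mem _ _ _

/-- The reflection negates the difference of the two unit vectors that it exchanges. That difference
is nonzero only when `J` has more than one element. -/
theorem uniformReflection_apply (j₀ : J) (hJ : 1 < Fintype.card J) {i j : J}
    (hij : i = j₀ ∨ j = j₀) :
    uniformReflection j₀ i j = ((1 / √(Fintype.card J) : ℝ) : ℂ) := by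
  have hc : (1 : ℝ) < √(Fintype.card J) := by
    rw [Real.lt_sqrt (by norm_num)]; simpa using hJ
  have hs : √(Fintype.card J : ℝ) ^ 2 = Fintype.card J := Real.sq_sqrt (by positivity)
  set r := √(Fintype.card J : ℝ) with hr
  have hw : fiberWeight (fun _ : J => ()) (fun j => (if j = j₀ then 1 else 0) - 1 / r) () =
      2 * (1 - 1 / r) := by
    have : ∀ j : J, ((if j = j₀ then (1 : ℝ) else 0) - 1 / r) ^ 2 =
        (if j = j₀ then (1 - 2 / r) else 0) + 1 / r ^ 2 := by
      intro j
      split_ifs <;> ring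
    simp only [fiberWeight, if_true, this, Finset.sum_add_distrib, Finset.sum_ite_eq',
      Finset.mem_univ, Finset.sum_const, Finset.card_univ, nsmul_eq_mul]
    rw [← hs]
    field_simp
    ring
  have hr1 : r - 1 ≠ 0 := by linarith
  have key : uniformReflection j₀ i j = (((if i = j then 1 else 0) - 2 *
      (((if i = j₀ then 1 else 0) - 1 / r) * ((if j = j₀ then 1 else 0) - 1 / r) /
        (2 * (1 - 1 / r))) : ℝ) : ℂ) := by
    rw [uniformReflection, fiberReflection, Matrix.sub_apply, Matrix.smul_apply, fiberProjection,
      ← hr, hw]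
    by_cases h : i = j <;> simp [Matrix.one_apply, h]
  rw [key]
  congr 1
  have h1 : (1 - 1 / r) ≠ 0 := by
    rw [one_sub_div (by linarith)]; exact div_ne_zero hr1 (by linarith)
  rcases hij with rfl | rfl
  · by_cases h : j = i
    · subst h; simp only [if_true]; field_simp; ring
    · simp only [h, Ne.symm h, if_true, if_false]; field_simp; ring
  · by_cases h : i = j
    · subst h; simp only [if_true]; field_simp; ring
    · simp only [h, if_true, if_false]; field_simp; ring

end UniformReflection

/-! ### Averages of the iterates of a unitary. -/

section Average

variable {ι : Type*} [Fintype ι] [DecidableEq ι]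

/-- The average of the first `M` iterates of `e` under `U`. -/
noncomputable def iterateAverage (U : Matrix ι ι ℂ) (e : ι → ℂ) (M : ℕ) : ι → ℂ :=
  (1 / M : ℂ) • ∑ j ∈ Finset.range M, (U ^ j).mulVec e

theorem norm_toLp_mulVec {U : Matrix ι ι ℂ} (hU : U ∈ Matrix.unitaryGroup ι ℂ) (α : ι → ℂ) :
    ‖WithLp.toLp 2 (U.mulVec α)‖ = ‖WithLp.toLp 2 α‖ := by
  have := normSum_mulVec hU α
  rw [normSum_eq_norm_sq, normSum_eq_norm_sq] at this
  exact (sq_eq_sq₀ (norm_nonneg _) (norm_nonneg _)).1 this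

/-- If `2 e = z - U z`, the iterates of `e` telescope and their average is small. -/
theorem normSum_iterateAverage_le {U : Matrix ι ι ℂ} (hU : U ∈ Matrix.unitaryGroup ι ℂ)
    {e z : ι → ℂ} (he : (2 : ℂ) • e = z - U.mulVec z) (M : ℕ) :
    normSum (iterateAverage U e M) ≤ normSum z / M ^ 2 := by
  have htel : ∑ j ∈ Finset.range M, (U ^ j).mulVec e = (1 / 2 : ℂ) • (z - (U ^ M).mulVec z) := by
    have he' : e = (1 / 2 : ℂ) • (z - U.mulVec z) := by rw [← he, smul_smul]; norm_num
    have hj : ∀ j, (U ^ j).mulVec e =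
        (1 / 2 : ℂ) • ((U ^ j).mulVec z - (U ^ (j + 1)).mulVec z) := by
      intro j
      rw [he', Matrix.mulVec_smul, Matrix.mulVec_sub, Matrix.mulVec_mulVec, ← pow_succ]
    simp only [hj]
    rw [← Finset.smul_sum, Finset.sum_range_sub']
    simp
  have hn : ‖WithLp.toLp 2 (iterateAverage U e M)‖ ≤ ‖WithLp.toLp 2 z‖ / M := by
    rw [iterateAverage, htel, WithLp.toLp_smul, WithLp.toLp_smul, WithLp.toLp_sub, norm_smul,
      norm_smul]
    have h1 := norm_sub_le (WithLp.toLp 2 z) (WithLp.toLp 2 ((U ^ M).mulVec z))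
    rw [norm_toLp_mulVec (pow_mem hU M)] at h1
    have h2 : ‖(1 / M : ℂ)‖ = 1 / M := by simp
    have h3 : ‖(1 / 2 : ℂ)‖ = 1 / 2 := by simp
    rw [h2, h3]
    calc 1 / (M : ℝ) * (1 / 2 * ‖WithLp.toLp 2 z - WithLp.toLp 2 ((U ^ M).mulVec z)‖)
        ≤ 1 / (M : ℝ) * (1 / 2 * (‖WithLp.toLp 2 z‖ + ‖WithLp.toLp 2 z‖)) := by gcongr
      _ = _ := by ring
  rw [normSum_eq_norm_sq, normSum_eq_norm_sq, ← div_pow]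
  gcongr

/-- If `φ` is fixed by `U` and has overlap one with `e`, the average iterate of `e` is large. -/
theorem one_le_normSum_iterateAverage {U : Matrix ι ι ℂ} (hU : U ∈ Matrix.unitaryGroup ι ℂ)
    {e φ : ι → ℂ} (hφ : U.mulVec φ = φ) (he : dotProduct (star φ) e = 1) {M : ℕ} (hM : 0 < M) :
    1 ≤ normSum φ * normSum (iterateAverage U e M) := by
  have hφj : ∀ j, Matrix.vecMul (star φ) (U ^ j) = star φ := by
    have h1 : Matrix.vecMul (star φ) U = star φ := by
      conv_lhs => rw [← hφ]
      rw [Matrix.star_mulVec, Matrix.vecMul_vecMul, ← Matrix.star_eq_conjTranspose,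
        Matrix.mem_unitaryGroup_iff'.1 hU, Matrix.vecMul_one]
    intro j
    induction j with
    | zero => simp
    | succ j ih => rw [pow_succ, ← Matrix.vecMul_vecMul, ih, h1]
  have hdot : dotProduct (star φ) (iterateAverage U e M) = 1 := by
    rw [iterateAverage, dotProduct_smul, dotProduct_sum]
    simp only [Matrix.dotProduct_mulVec, hφj, he]
    have : (M : ℂ) ≠ 0 := by exact_mod_cast hM.ne'
    simp [this]
  have hcs := norm_inner_le_norm (𝕜 := ℂ) (WithLp.toLp 2 φ)
    (WithLp.toLp 2 (iterateAverage U e M))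
  rw [EuclideanSpace.inner_toLp_toLp, dotProduct_comm, hdot, norm_one] at hcs
  rw [normSum_eq_norm_sq, normSum_eq_norm_sq, ← mul_pow]
  exact one_le_pow₀ hcs

end Average

/-! ### The walk on the edges of the tree. -/

/-! The positive integers below `2 * n` are the vertices of a binary tree with root `1`, in which
`v < n` has the children `2 * v` and `2 * v + 1` and the leaves are `n, …, 2 * n - 1`.  A vertex
also stands for the edge joining it to its parent. -/

namespace HeapTree

/-- The parity of the depth of a vertex. -/
def par (v : ℕ) : Bool := (Nat.log 2 v).bodd

theorem log_child {u k : ℕ} (hu : u ≠ 0) (hk : k < 2) :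
    Nat.log 2 (2 * u + k) = Nat.log 2 u + 1 := by
  rw [Nat.log_of_one_lt_of_le one_lt_two (by omega)]
  congr 2
  omega

theorem par_child {u k : ℕ} (hu : u ≠ 0) (hk : k < 2) : par (2 * u + k) = !par u := by
  simp [par, log_child hu hk]

theorem par_half {v : ℕ} (hv : 2 ≤ v) : par (v / 2) = !par v := by
  have h := par_child (u := v / 2) (k := v % 2) (by omega) (by omega)
  rw [Nat.div_add_mod] at h
  simp [h]

theorem par_one : par 1 = false := by simp [par]

variable {n : ℕ}

/-- The endpoint with depth of parity `p` of the edge above `v`. -/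
def endpoint (p : Bool) (v : Fin (2 * n)) : Fin (2 * n) :=
  if par v = p ∨ (v : ℕ) < 2 then v else ⟨v / 2, by omega⟩

/-- The vertices with depth of parity `p`. -/
def ofParity (p : Bool) (u : Fin (2 * n)) : Bool := decide (par u = p ∧ (u : ℕ) ≠ 0)

/-- The fibers of `endpoint p` are the stars: the edge above `u` and, when `u` is internal, the
edges above its two children. -/
theorem endpoint_eq_iff {p : Bool} {u v : Fin (2 * n)} (hu : ofParity p u) :
    endpoint p v = u ↔ (v : ℕ) = u ∨ (v : ℕ) = 2 * u ∨ (v : ℕ) = 2 * u + 1 := by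
  simp only [ofParity, decide_eq_true_eq] at hu
  obtain ⟨hp, h0⟩ := hu
  have h1 := par_child (k := 0) h0 (by norm_num)
  have h2 := par_child (k := 1) h0 (by norm_num)
  rw [add_zero] at h1
  rw [Fin.ext_iff, endpoint]
  split_ifs with h
  · constructor
    · exact Or.inl
    · rintro (h' | h' | h')
      · exact h'
      · rw [h', h1, hp] at h
        rcases h with h | h
        · simp at h
        · omega
      · rw [h', h2, hp] at h
        rcases h with h | h
        · simp at h
        · omega
  · push Not at h
    constructor
    · intro h'; simp only at h'; omega
    · rintro (h' | h' | h')
      · rw [h'] at h; exact absurd hp h.1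
      · simp only; omega
      · simp only; omega

theorem ofParity_endpoint {p : Bool} {v : Fin (2 * n)} (h0 : (v : ℕ) ≠ 0)
    (h : 2 ≤ (v : ℕ) ∨ par v = p) : ofParity p (endpoint p v) = true := by
  rw [ofParity, decide_eq_true_eq, endpoint]
  split_ifs with h'
  · refine ⟨?_, h0⟩
    rcases h with h | h
    · exact h'.resolve_right (by omega)
    · exact h
  · push Not at h'
    simp only [par_half h'.2]
    exact ⟨by have := h'.1; revert this; cases par v <;> cases p <;> simp, by omega⟩

/-- The square root of the weight of the edge above `v`. -/
noncomputable def amplitude (n v : ℕ) : ℝ :=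
  if v = 0 then 0 else if v = 1 then 1 else √(8 * √(2 * n) / √v)

theorem amplitude_pos {n v : ℕ} (hn : n ≠ 0) (hv : v ≠ 0) : 0 < amplitude n v := by
  have : 0 < (n : ℝ) := by positivity
  have : 0 < (v : ℝ) := by positivity
  rw [amplitude, if_neg hv]
  split_ifs <;> positivity

theorem amplitude_sq {n v : ℕ} (hv : 2 ≤ v) : amplitude n v ^ 2 = 8 * √(2 * n) / √v := by
  rw [amplitude, if_neg (by omega), if_neg (by omega), Real.sq_sqrt (by positivity)]

/-- The reflection at all vertices with depth of parity `p`. -/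
noncomputable def reflection (n : ℕ) (p : Bool) : Matrix (Fin (2 * n)) (Fin (2 * n)) ℂ :=
  fiberReflection (endpoint p) (fun v => amplitude n v) (ofParity p)

/-- The bit of the string `x` at the leaf `v`. -/
def leafBit (x : Fin n → Bool) (v : Fin (2 * n)) : Bool :=
  if h : n ≤ (v : ℕ) then x ⟨v - n, by omega⟩ else false

/-- The sign flip at the leaves where both strings have a one. -/
noncomputable def markMatrix (x y : Fin n → Bool) : Matrix (Fin (2 * n)) (Fin (2 * n)) ℂ :=
  Matrix.diagonal fun v => if leafBit x v && leafBit y v then -1 else 1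

/-- The walk operator. -/
noncomputable def walk (x y : Fin n → Bool) : Matrix (Fin (2 * n)) (Fin (2 * n)) ℂ :=
  reflection n true * markMatrix x y * reflection n false

theorem walk_mem (x y : Fin n → Bool) : walk x y ∈ Matrix.unitaryGroup (Fin (2 * n)) ℂ := by
  refine mul_mem (mul_mem (fiberReflection_mem _ _ _) ?_) (fiberReflection_mem _ _ _)
  rw [Matrix.mem_unitaryGroup_iff, markMatrix, Matrix.star_eq_conjTranspose,
    Matrix.diagonal_conjTranspose, Matrix.diagonal_mul_diagonal, ← Matrix.diagonal_one]
  congr 1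
  funext v
  simp only [Pi.star_apply]
  split_ifs <;> simp

/-- The root of the tree. -/
def root (hn : n ≠ 0) : Fin (2 * n) := ⟨1, by omega⟩

/-! ### No common one: total weight. -/

section Unmarked

/-- Every edge has an end of even depth, so the amplitude vector is a sum of star vectors of even
depth. -/
theorem reflection_false_amplitude :
    (reflection n false).mulVec (fun v => (amplitude n v : ℂ)) =
      -fun v : Fin (2 * n) => (amplitude n v : ℂ) := by
  funext v
  rw [reflection, fiberReflection_mulVec_self]
  by_cases h0 : (v : ℕ) = 0
  · simp [h0, amplitude]
  · rw [if_pos]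
    · simp
    · refine ofParity_endpoint h0 ?_
      by_cases h1 : (v : ℕ) = 1
      · exact Or.inr (by rw [h1, par_one])
      · exact Or.inl (by omega)

/-- The root edge is the only edge without an end of odd depth; its coordinate keeps its sign, which
accounts for the term at the root. -/
theorem reflection_true_amplitude (hn : n ≠ 0) :
    (reflection n true).mulVec (fun v => (amplitude n v : ℂ)) =
      (2 : ℂ) • Pi.single (root hn) 1 - fun v : Fin (2 * n) => (amplitude n v : ℂ) := by
  funext v
  rw [reflection, fiberReflection_mulVec_self]
  by_cases h0 : (v : ℕ) = 0
  · have : v ≠ root hn := by rintro rfl; simp [root] at h0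
    simp [h0, amplitude, this]
  by_cases h1 : (v : ℕ) = 1
  · have : v = root hn := Fin.ext h1
    rw [if_neg]
    · rw [this]
      simp [amplitude, root]
      norm_num
    · simp [ofParity, endpoint, h1, par_one]
  · have : v ≠ root hn := by rintro rfl; simp [root] at h1
    rw [if_pos (ofParity_endpoint h0 (Or.inl (by omega)))]
    simp [this]

theorem two_smul_root_eq (hn : n ≠ 0) {x y : Fin n → Bool} (hxy : ∀ i, ¬(x i = true ∧ y i = true)) :
    (2 : ℂ) • Pi.single (root hn) 1 = (fun v : Fin (2 * n) => (amplitude n v : ℂ)) -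
      (walk x y).mulVec (fun v : Fin (2 * n) => (amplitude n v : ℂ)) := by
  have hM : markMatrix x y = 1 := by
    rw [markMatrix, ← Matrix.diagonal_one]
    congr 1
    funext v
    rw [if_neg]
    simp only [leafBit, Bool.and_eq_true]
    split_ifs
    · exact hxy _
    · simp
  rw [walk, hM, mul_one, ← Matrix.mulVec_mulVec, reflection_false_amplitude, Matrix.mulVec_neg,
    reflection_true_amplitude hn]
  abel

theorem sum_range_inv_sqrt_le (N : ℕ) : ∑ v ∈ Finset.range (N + 1), 1 / √(v : ℝ) ≤ 2 * √N := by
  induction N with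
  | zero => simp
  | succ N ih =>
    rw [Finset.sum_range_succ]
    have hb : 0 < √((N + 1 : ℕ) : ℝ) := Real.sqrt_pos.2 (by positivity)
    have h1 : √(N : ℝ) ^ 2 = N := Real.sq_sqrt (by positivity)
    have h2 : √((N + 1 : ℕ) : ℝ) ^ 2 = N + 1 := by rw [Real.sq_sqrt (by positivity)]; simp
    -- With `b² - a² = 1`, the bound `1 ≤ 2 b² - 2 a b` is `(b - a)² ≥ 0`.
    have h3 : 1 / √((N + 1 : ℕ) : ℝ) ≤ 2 * √((N + 1 : ℕ) : ℝ) - 2 * √(N : ℝ) := by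
      rw [div_le_iff₀ hb]
      nlinarith [sq_nonneg (√((N + 1 : ℕ) : ℝ) - √(N : ℝ))]
    linarith

theorem normSum_amplitude_le (n : ℕ) :
    normSum (fun v : Fin (2 * n) => (amplitude n v : ℂ)) ≤ 1 + 32 * n := by
  have h1 : ∀ v : ℕ, ‖(amplitude n v : ℂ)‖ ^ 2 ≤
      (if v = 1 then 1 else 0) + 8 * √(2 * n) * (1 / √v) := by
    intro v
    rw [Complex.norm_real, Real.norm_eq_abs, sq_abs]
    by_cases h0 : v = 0
    · simp [h0, amplitude]
    by_cases h1 : v = 1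
    · simp [h1, amplitude]
    · rw [amplitude_sq (by omega), if_neg h1, zero_add, mul_one_div]
  rw [normSum, Fin.sum_univ_eq_sum_range (fun v => ‖(amplitude n v : ℂ)‖ ^ 2)]
  calc _ ≤ ∑ v ∈ Finset.range (2 * n + 1), ‖(amplitude n v : ℂ)‖ ^ 2 :=
        Finset.sum_le_sum_of_subset_of_nonneg (Finset.range_mono (by omega))
          fun _ _ _ => by positivity
    _ ≤ ∑ v ∈ Finset.range (2 * n + 1), ((if v = 1 then 1 else 0) + 8 * √(2 * n) * (1 / √v)) :=
        Finset.sum_le_sum fun v _ => h1 v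
    _ ≤ 1 + 8 * √(2 * n) * (2 * √((2 * n : ℕ) : ℝ)) := by
        rw [Finset.sum_add_distrib, ← Finset.mul_sum]
        gcongr
        · rw [Finset.sum_ite_eq']
          split_ifs <;> norm_num
        · exact sum_range_inv_sqrt_le _
    _ = 1 + 32 * n := by
        push_cast
        have : √(2 * n : ℝ) ^ 2 = 2 * n := Real.sq_sqrt (by positivity)
        nlinarith

end Unmarked

/-! ### A common one: the flow to a marked leaf. -/

section Marked

/-- `v` lies on the path from the root to `m`. -/
def IsAncestor (m v : ℕ) : Prop := v ≠ 0 ∧ m / 2 ^ (Nat.log 2 m - Nat.log 2 v) = v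

open Classical in
/-- The alternating unit flow from the root to the vertex `m`. -/
noncomputable def flow (m v : ℕ) : ℝ := if IsAncestor m v then (-1) ^ Nat.log 2 v else 0

/-- Kirchhoff's law: a path through `u` continues to exactly one child, and the alternating signs
turn conservation into a vanishing sum. -/
theorem flow_vertex {m u : ℕ} (hu : u ≠ 0) (hum : u < m) :
    flow m u + flow m (2 * u) + flow m (2 * u + 1) = 0 := by
  have l1 := log_child (k := 0) hu (by norm_num)
  have l2 := log_child (k := 1) hu (by norm_num)
  rw [add_zero] at l1
  have hm : m ≠ 0 := by omega
  by_cases hlog : Nat.log 2 m ≤ Nat.log 2 u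
  · have e1 : Nat.log 2 m - Nat.log 2 u = 0 := by omega
    have e2 : Nat.log 2 m - (Nat.log 2 u + 1) = 0 := by omega
    have n1 : m ≠ 2 * u := by rintro rfl; omega
    have n2 : m ≠ 2 * u + 1 := by rintro rfl; omega
    simp [flow, IsAncestor, l1, l2, e1, e2, n1, n2, hum.ne']
  · obtain ⟨d, hd⟩ : ∃ d, Nat.log 2 m - Nat.log 2 u = d + 1 :=
      ⟨Nat.log 2 m - Nat.log 2 u - 1, by omega⟩
    have hd' : Nat.log 2 m - (Nat.log 2 u + 1) = d := by omega
    simp only [flow, IsAncestor, l1, l2, hd, hd', pow_succ, ← Nat.div_div_eq_div_mul]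
    -- `q` is the ancestor of `m` at the level of the children of `u`, so the parity of `q` tells
    -- which child is on the path.
    generalize m / 2 ^ d = q
    by_cases h : q / 2 = u
    · rcases Nat.mod_two_eq_zero_or_one q with hq | hq
      · rw [if_pos ⟨hu, h⟩, if_pos ⟨by omega, by omega⟩, if_neg (by omega)]; ring
      · rw [if_pos ⟨hu, h⟩, if_neg (by omega), if_pos ⟨by omega, by omega⟩]; ring
    · rw [if_neg (by tauto), if_neg (by omega), if_neg (by omega)]; ring

/-- The vector fixed by the walk if the leaf `m` is marked. -/
noncomputable def potential (n m v : ℕ) : ℝ := flow m v / amplitude n v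

theorem flow_leaf {m v : ℕ} (hm : m < 2 * n) (hv : n ≤ v) (hvm : v ≠ m) : flow m v = 0 := by
  rw [flow, if_neg]
  rintro ⟨h0, h⟩
  rcases Nat.eq_zero_or_pos (Nat.log 2 m - Nat.log 2 v) with h1 | h1
  · rw [h1] at h; simp at h; omega
  · obtain ⟨d, hd⟩ : ∃ d, Nat.log 2 m - Nat.log 2 v = d + 1 := ⟨_, (Nat.succ_pred_eq_of_pos h1).symm⟩
    rw [hd, pow_succ, mul_comm, ← Nat.div_div_eq_div_mul] at h
    have := Nat.div_le_self (m / 2) (2 ^ d)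
    omega

/-- The product of amplitude and potential is the flow, so Kirchhoff's law makes the potential
orthogonal to every internal star. The star of a leaf is one edge, which the reflection negates;
among the leaves only `m` carries flow. -/
theorem reflection_potential (p : Bool) {m : Fin (2 * n)} (hm : n ≤ (m : ℕ)) (i : Fin (2 * n)) :
    (reflection n p).mulVec (fun v => (potential n m v : ℂ)) i =
      (if i = m ∧ par m = p then -1 else 1) * (potential n m i : ℂ) := by
  have hn : n ≠ 0 := by have := m.2; omega
  rw [reflection, fiberReflection_mulVec]
  by_cases hS : ofParity p (endpoint p i) = true
  · rw [if_pos hS]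
    have hu := hS
    simp only [ofParity, decide_eq_true_eq] at hu
    have hiu := (endpoint_eq_iff (v := i) hS).1 rfl
    set u := endpoint p i with hu_def
    have hterm : ∀ j : Fin (2 * n), amplitude n j * potential n m j = flow m j := by
      intro j
      by_cases h0 : (j : ℕ) = 0
      · simp [h0, flow, IsAncestor, amplitude]
      · rw [potential, mul_div_cancel₀ _ (amplitude_pos hn h0).ne']
    simp only [hterm, endpoint_eq_iff hS]
    by_cases hun : (u : ℕ) < n
    · have hsum : ∑ j : Fin (2 * n), (if (j : ℕ) = u ∨ (j : ℕ) = 2 * u ∨ (j : ℕ) = 2 * u + 1 then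
          flow m j else 0) = 0 := by
        have hj : ∀ j : Fin (2 * n), (if (j : ℕ) = u ∨ (j : ℕ) = 2 * u ∨ (j : ℕ) = 2 * u + 1 then
            flow m j else 0) = (if j = u then flow m u else 0) +
              (if j = ⟨2 * u, by omega⟩ then flow m (2 * u) else 0) +
              (if j = ⟨2 * u + 1, by omega⟩ then flow m (2 * u + 1) else 0) := by
          intro j
          simp only [Fin.ext_iff]
          by_cases a1 : (j : ℕ) = u
          · rw [if_pos (Or.inl a1), if_pos a1, if_neg (by omega), if_neg (by omega), a1]; ring
          by_cases a2 : (j : ℕ) = 2 * u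
          · rw [if_pos (Or.inr (Or.inl a2)), if_neg a1, if_pos a2, if_neg (by omega), a2]; ring
          by_cases a3 : (j : ℕ) = 2 * u + 1
          · rw [if_pos (Or.inr (Or.inr a3)), if_neg a1, if_neg a2, if_pos a3, a3]; ring
          · rw [if_neg (by tauto), if_neg a1, if_neg a2, if_neg a3]; ring
        simp only [hj, Finset.sum_add_distrib, Finset.sum_ite_eq', Finset.mem_univ, if_true]
        exact flow_vertex hu.2 (by omega)
      rw [hsum]
      have : ¬(i = m ∧ par m = p) := by
        rintro ⟨rfl, h⟩
        have : u = i := by rw [hu_def, endpoint, if_pos (Or.inl h)]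
        omega
      simp [this]
    -- Here `u` is a leaf: its children would have indices at least `2 * n`.
    · have hiu' : i = u := Fin.ext (by omega)
      have hju : ∀ j : Fin (2 * n), ((j : ℕ) = u ∨ (j : ℕ) = 2 * u ∨ (j : ℕ) = 2 * u + 1) ↔
          j = u := fun j => by rw [Fin.ext_iff]; omega
      have hw : fiberWeight (endpoint p) (fun v : Fin (2 * n) => amplitude n v) u =
          amplitude n u ^ 2 := by
        simp only [fiberWeight, endpoint_eq_iff hS, hju, Finset.sum_ite_eq', Finset.mem_univ,
          if_true]
      have ha := (amplitude_pos hn hu.2).ne'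
      simp only [hju, Finset.sum_ite_eq', Finset.mem_univ, if_true, hw]
      rw [hiu', potential]
      by_cases h : u = m
      · rw [if_pos ⟨h, by rw [← h]; exact hu.1⟩, ← Complex.ofReal_one, ← Complex.ofReal_neg,
          ← Complex.ofReal_mul]
        congr 1
        field_simp
        ring
      · rw [flow_leaf m.2 (by omega) fun h' => h (Fin.ext h')]
        simp
  · rw [if_neg hS, if_neg]
    · simp
    · rintro ⟨rfl, h⟩
      apply hS
      rw [endpoint, if_pos (Or.inl h)]
      simp only [ofParity, decide_eq_true_eq]
      exact ⟨h, by omega⟩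

/-- Other marked leaves do no harm, since the potential vanishes there. -/
theorem markMatrix_potential {x y : Fin n → Bool} {i : Fin n} (hx : x i = true) (hy : y i = true)
    (v : Fin (2 * n)) :
    (if leafBit x v && leafBit y v then (-1 : ℂ) else 1) * (potential n (n + i) v : ℂ) =
      (if v = ⟨n + i, by omega⟩ then -1 else 1) * (potential n (n + i) v : ℂ) := by
  by_cases hv : v = ⟨n + i, by omega⟩
  · subst hv
    simp [leafBit, hx, hy]
  · rw [if_neg hv]
    by_cases hvn : n ≤ (v : ℕ)
    · rw [potential, flow_leaf (n := n) (by omega) hvn fun h => hv (Fin.ext h)]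
      simp
    · simp [leafBit, hvn]

theorem walk_potential {x y : Fin n → Bool} {i : Fin n} (hx : x i = true) (hy : y i = true) :
    (walk x y).mulVec (fun v => (potential n (n + i) v : ℂ)) =
      fun v : Fin (2 * n) => (potential n (n + i) v : ℂ) := by
  set m : Fin (2 * n) := ⟨n + i, by omega⟩ with hm
  have hmn : n ≤ (m : ℕ) := by simp [hm]
  set φ : Fin (2 * n) → ℂ := fun v => (potential n (n + i) v : ℂ) with hφ
  have hR : ∀ p, (reflection n p).mulVec φ =
      if par m = p then (markMatrix x y).mulVec φ else φ := by
    intro p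
    funext v
    have h1 := reflection_potential p hmn v
    have h2 := markMatrix_potential hx hy v
    rw [show (m : ℕ) = n + i from rfl] at h1
    rw [h1]
    split_ifs with h3 h4 h5
    · rw [markMatrix, Matrix.mulVec_diagonal, hφ, h2, if_pos h3.1]
    · exact absurd h3.2 h4
    · rw [markMatrix, Matrix.mulVec_diagonal, hφ, h2, if_neg (fun h => h3 ⟨h, h5⟩)]
    · simp [hφ]
  have hinv : ∀ p, (reflection n p) * (reflection n p) = 1 :=
    fun p => fiberReflection_mul_self _ _ _
  rw [walk, ← Matrix.mulVec_mulVec, ← Matrix.mulVec_mulVec, hR false]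
  -- On the potential, the reflection of the parity of `m` acts as the sign flip and the other one
  -- as the identity. The two flips cancel, the reflection and the flip being involutions.
  cases hp : par m
  · have hMM : (markMatrix x y).mulVec ((markMatrix x y).mulVec φ) = φ := by
      funext v
      rw [markMatrix, Matrix.mulVec_diagonal, Matrix.mulVec_diagonal]
      split_ifs <;> ring
    rw [if_pos rfl, hMM, hR true, hp]
    simp
  · have h := hR true
    rw [hp, if_pos rfl] at h
    rw [if_neg (by simp), ← h, Matrix.mulVec_mulVec, hinv, Matrix.one_mulVec]

theorem flow_root {m : ℕ} (hm : m ≠ 0) : flow m 1 = 1 := by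
  rw [flow, if_pos]
  · simp
  · refine ⟨one_ne_zero, ?_⟩
    have h1 := Nat.pow_log_le_self 2 hm
    have h2 := Nat.lt_pow_succ_log_self one_lt_two m
    rw [Nat.log_one_right, Nat.sub_zero]
    refine Nat.div_eq_of_lt_le (by omega) ?_
    rw [pow_succ] at h2
    omega

theorem potential_root (n : ℕ) {m : ℕ} (hm : m ≠ 0) : potential n m 1 = 1 := by
  simp [potential, flow_root hm, amplitude]

/-- The true ratio is `√(1 / 2)`; `3 / 4` is a rational upper bound, as `1 / 2 ≤ 9 / 16`. -/
theorem sqrt_div_two_pow_le (m i : ℕ) : √((m / 2 ^ i : ℕ) : ℝ) ≤ √m * (3 / 4) ^ i := by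
  refine Real.sqrt_le_iff.2 ⟨by positivity, ?_⟩
  rw [mul_pow, Real.sq_sqrt (by positivity), ← pow_mul, mul_comm i, pow_mul]
  calc ((m / 2 ^ i : ℕ) : ℝ) ≤ (m : ℝ) / ((2 ^ i : ℕ) : ℝ) := Nat.cast_div_le
    _ = m * (1 / 2) ^ i := by push_cast; rw [one_div, inv_pow]; rfl
    _ ≤ _ := by gcongr; norm_num

/-- The root edge contributes 1. The other resistances decrease geometrically from the leaf upwards
and sum to at most `4 / 8`; the factor 8 in the weights is chosen for this. -/
theorem normSum_potential_le {m : ℕ} (hm : m < 2 * n) :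
    normSum (fun v : Fin (2 * n) => (potential n m v : ℂ)) ≤ 3 / 2 := by
  have hn : n ≠ 0 := by omega
  have hs : 0 < √(2 * n : ℝ) := Real.sqrt_pos.2 (by positivity)
  have hv : ∀ v : ℕ, ‖(potential n m v : ℂ)‖ ^ 2 ≤ (if v = 1 then 1 else 0) +
      ∑ i ∈ Finset.range (Nat.log 2 m + 1),
        if v = m / 2 ^ i then √(v : ℝ) / (8 * √(2 * n)) else 0 := by
    intro v
    have hnn : 0 ≤ ∑ i ∈ Finset.range (Nat.log 2 m + 1),
        if v = m / 2 ^ i then √(v : ℝ) / (8 * √(2 * n)) else 0 :=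
      Finset.sum_nonneg fun i _ => by split_ifs <;> positivity
    rw [Complex.norm_real, Real.norm_eq_abs, sq_abs, potential, div_pow]
    by_cases ha : IsAncestor m v
    · rw [flow, if_pos ha, ← pow_mul, mul_comm, pow_mul]
      by_cases h1 : v = 1
      · rw [if_pos h1, h1]
        simpa [amplitude, h1] using hnn
      · have h0 := ha.1
        rw [if_neg h1, zero_add, amplitude_sq (by omega)]
        refine le_trans (le_of_eq ?_) (Finset.single_le_sum
          (f := fun i => if v = m / 2 ^ i then √(v : ℝ) / (8 * √(2 * n)) else 0)
          (fun i _ => by split_ifs <;> positivity)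
          (Finset.mem_range.2 (show Nat.log 2 m - Nat.log 2 v < _ by omega)))
        simp only [if_pos ha.2.symm]
        simp
    · rw [flow, if_neg ha]
      have : (0 : ℝ) ≤ if v = 1 then 1 else 0 := by split_ifs <;> norm_num
      simp only [ne_eq, OfNat.ofNat_ne_zero, not_false_eq_true, zero_pow, zero_div]
      linarith
  rw [normSum, Fin.sum_univ_eq_sum_range (fun v => ‖(potential n m v : ℂ)‖ ^ 2)]
  have hgeom : ∑ i ∈ Finset.range (Nat.log 2 m + 1), (3 / 4 : ℝ) ^ i ≤ 4 := by
    rw [geom_sum_eq (by norm_num), div_le_iff_of_neg (by norm_num)]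
    have : (0 : ℝ) ≤ (3 / 4) ^ (Nat.log 2 m + 1) := by positivity
    linarith
  have hmn : √(m : ℝ) ≤ √(2 * n) := Real.sqrt_le_sqrt (by exact_mod_cast hm.le)
  calc _ ≤ ∑ v ∈ Finset.range (2 * n), ((if v = 1 then (1 : ℝ) else 0) +
      ∑ i ∈ Finset.range (Nat.log 2 m + 1),
        if v = m / 2 ^ i then √(v : ℝ) / (8 * √(2 * n)) else 0) :=
        Finset.sum_le_sum fun v _ => hv v
    _ ≤ 1 + ∑ i ∈ Finset.range (Nat.log 2 m + 1), √(2 * n) * (3 / 4) ^ i / (8 * √(2 * n)) := by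
        rw [Finset.sum_add_distrib, Finset.sum_comm]
        gcongr with i hi
        · rw [Finset.sum_ite_eq']
          split_ifs <;> norm_num
        · rw [Finset.sum_ite_eq']
          have := sqrt_div_two_pow_le m i
          split_ifs
          · gcongr
            exact this.trans (by gcongr)
          · positivity
    _ = 1 + (∑ i ∈ Finset.range (Nat.log 2 m + 1), (3 / 4 : ℝ) ^ i) / 8 := by
        rw [Finset.sum_div]
        congr 1
        refine Finset.sum_congr rfl fun i _ => ?_
        field_simp
    _ ≤ 3 / 2 := by linarith

end Marked

end HeapTree

/-! ### Realizing the walk by messages. -/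

namespace HeapTree

open DrivenStep

/-- `v` is a child of parity `k` of a vertex with depth of parity `p`. -/
def isChild (p : Bool) (k v : ℕ) : Bool := decide (par v ≠ p ∧ 2 ≤ v ∧ v % 2 = k)

variable {n M : ℕ}

/-- Exchanges each vertex with depth of parity `p` with its child of parity `k`. -/
def childSwap (p : Bool) (k : Fin 2) (v : Fin (2 * n)) : Fin (2 * n) :=
  if h : par v = p ∧ (v : ℕ) ≠ 0 ∧ 2 * (v : ℕ) + k < 2 * n then ⟨2 * v + k, h.2.2⟩
  else if isChild p k v then ⟨v / 2, by omega⟩ else v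

theorem childSwap_of_isChild {p : Bool} {k : Fin 2} {v : Fin (2 * n)} (h : isChild p k v = true) :
    childSwap p k v = ⟨v / 2, by omega⟩ := by
  have h' := h
  simp only [isChild, decide_eq_true_eq] at h'
  rw [childSwap, dif_neg (fun h'' => h'.1 h''.1), if_pos h]

theorem childSwap_half {p : Bool} {k : Fin 2} {v : Fin (2 * n)} (h : isChild p k v = true) :
    childSwap p k ⟨v / 2, by omega⟩ = v := by
  simp only [isChild, decide_eq_true_eq] at h
  have hp : par ((v : ℕ) / 2) = p := by
    rw [par_half h.2.1]
    have := h.1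
    revert this
    cases par v <;> cases p <;> simp
  have hv := v.2
  rw [childSwap, dif_pos ⟨hp, by simp only; omega, by simp only; omega⟩]
  ext
  simp only
  omega

theorem childSwap_involutive (p : Bool) (k : Fin 2) :
    Function.Involutive (childSwap p k : Fin (2 * n) → Fin (2 * n)) := by
  intro v
  by_cases h : par v = p ∧ (v : ℕ) ≠ 0 ∧ 2 * (v : ℕ) + k < 2 * n
  · rw [show childSwap p k v = ⟨2 * v + k, h.2.2⟩ by rw [childSwap, dif_pos h],
      childSwap_of_isChild]
    · ext
      simp only
      omega
    · simp only [isChild, decide_eq_true_eq, par_child h.2.1 k.2, h.1]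
      refine ⟨by simp, by omega, by omega⟩
  · by_cases h' : isChild p k v = true
    · rw [childSwap_of_isChild h', childSwap_half h']
    · have : childSwap p k v = v := by rw [childSwap, dif_neg h, if_neg h']
      rw [this, this]

/-- The steps of the protocol: Alice holds a vertex and a counter, Bob a vertex and an output
bit. -/
abbrev Step (n M : ℕ) : Type :=
  DrivenStep (Fin n → Bool) (Fin n → Bool) (Fin (2 * n) × Fin M) (Fin (2 * n) × Bool)

/-- Bob moves between the two ends of an edge leading to a child of parity `k`. -/
def swapStep (p : Bool) (k : Fin 2) : Step n M where
  W _ := 1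
  g _ a := isChild p k a.1
  σ := (childSwap_involutive p k).toPerm.prodCongr (Equiv.refl Bool)
  flip _ _ := false

/-- Alice applies a unitary that does not depend on the input. -/
def localStep (W : Matrix.unitaryGroup (Fin (2 * n) × Fin M) ℂ) : Step n M where
  W _ := W
  g _ _ := false
  σ := 1
  flip _ _ := false

/-- The reflection at the vertices of one parity, performed if the counter exceeds `t`. -/
noncomputable def controlledReflection (p : Bool) (t : ℕ) :
    Matrix.unitaryGroup (Fin (2 * n) × Fin M) ℂ :=
  ⟨_, blockDiagonal_mem_unitaryGroup
    (U := fun j : Fin M => if t < j then reflection n p else 1) fun j => by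
      split_ifs
      · exact fiberReflection_mem _ _ _
      · exact one_mem _⟩

/-- The sign flip at marked leaves, performed if the counter exceeds `t`. -/
def markStep (t : ℕ) : Step n M where
  W _ := 1
  g x a := leafBit x a.1 && decide (t < (a.2 : ℕ))
  σ := 1
  flip y b := leafBit y b.1

/-- Alice exchanges the basis state `j₀` of the counter and the uniform superposition. -/
noncomputable def counterReflection (j₀ : Fin M) :
    Matrix.unitaryGroup (Fin (2 * n) × Fin M) ℂ :=
  ⟨_, submatrix_equiv_mem_unitaryGroup
    (blockDiagonal_mem_unitaryGroup (o := Fin (2 * n)) fun _ => uniformReflection_mem j₀)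
    (Equiv.prodComm _ _) (Equiv.prodComm _ _)⟩

/-- Alice tells Bob whether the counter is `j₀`. -/
def storeStep (j₀ : Fin M) : Step n M where
  W _ := 1
  g _ a := decide (a.2 = j₀)
  σ := (Equiv.refl _).prodCongr Equiv.boolNot
  flip _ _ := false

/-- The reflection at the vertices of one parity. -/
noncomputable def halfRound (p : Bool) (t : ℕ) : List (Step n M) :=
  [swapStep p 0, swapStep p 1, localStep (controlledReflection p t), swapStep p 0, swapStep p 1]

/-- One application of the walk operator. -/
noncomputable def walkRound (t : ℕ) : List (Step n M) :=
  halfRound false t ++ (markStep t :: halfRound true t)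

/-- The first `t` applications of the walk operator. -/
noncomputable def walkRounds : ℕ → List (Step n M)
  | 0 => []
  | t + 1 => walkRounds t ++ walkRound t

theorem length_walkRounds (t : ℕ) : (walkRounds t : List (Step n M)).length = 11 * t := by
  induction t with
  | zero => rfl
  | succ t ih => simp [walkRounds, ih, walkRound, halfRound]; ring

variable {x y : Fin n → Bool} {a₀ : Fin (2 * n) × Fin M} {b₀ : Fin (2 * n) × Bool}
  {l : List (Step n M)} {α : Fin (2 * n) × Fin M → ℂ}

/-- The content of Bob's register that is a copy of Alice's vertex. -/
def vertexCopy (a : Fin (2 * n) × Fin M) : Fin (2 * n) × Bool := (a.1, false)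

theorem reaches_swapStep {h h' : Fin (2 * n) × Fin M → Fin (2 * n) × Bool} (p : Bool) (k : Fin 2)
    (H : Reaches x y a₀ b₀ l h α)
    (hh : ∀ a, h' a = if isChild p k a.1 then (childSwap p k (h a).1, (h a).2) else h a) :
    Reaches x y a₀ b₀ (l ++ [swapStep p k]) h' α := by
  refine H.snoc _ (fun a a' ha => ?_) hh fun a => ?_
  · rw [not_imp_comm.1 (fun hne => Matrix.one_apply_ne hne) ha]
  · simp [swapStep]

theorem reaches_localStep {h : Fin (2 * n) × Fin M → Fin (2 * n) × Bool}
    (W : Matrix.unitaryGroup (Fin (2 * n) × Fin M) ℂ) (H : Reaches x y a₀ b₀ l h α)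
    (hW : ∀ a a', (W : Matrix (Fin (2 * n) × Fin M) (Fin (2 * n) × Fin M) ℂ) a a' ≠ 0 →
      h a = h a') :
    Reaches x y a₀ b₀ (l ++ [localStep W]) h
      ((W : Matrix (Fin (2 * n) × Fin M) (Fin (2 * n) × Fin M) ℂ).mulVec α) :=
  H.snoc _ hW (fun a => by simp [localStep]) fun a => by simp [localStep]

theorem endpoint_eq (p : Bool) (v : Fin (2 * n)) :
    endpoint p v = if isChild p 0 v ∨ isChild p 1 v then ⟨v / 2, by omega⟩ else v := by
  rw [endpoint]
  simp only [isChild, decide_eq_true_eq]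
  split_ifs with h1 h2 h2
  · rcases h1 with h1 | h1
    · exact absurd h1 (h2.elim (·.1) (·.1))
    · omega
  · rfl
  · rfl
  · push Not at h1
    exact absurd h2 (by
      rcases Nat.mod_two_eq_zero_or_one v with h | h
      · exact not_not.2 (Or.inl ⟨h1.1, h1.2, h⟩)
      · exact not_not.2 (Or.inr ⟨h1.1, h1.2, h⟩))

theorem not_isChild_zero {p : Bool} {v : ℕ} (h : isChild p 1 v = true) : isChild p 0 v = false := by
  simp only [isChild, decide_eq_true_eq, decide_eq_false_iff_not] at h ⊢
  omega

/-- After two swaps Bob holds `endpoint p` of Alice's vertex, which is constant on the stars that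
her reflection mixes. The same swaps, controlled by her new vertex, then carry Bob down again to a
copy of it. -/
theorem reaches_halfRound (p : Bool) (t : ℕ) (H : Reaches x y a₀ b₀ l vertexCopy α) :
    Reaches x y a₀ b₀ (l ++ halfRound p t) vertexCopy fun a =>
      if t < (a.2 : ℕ) then (reflection n p).mulVec (fun v => α (v, a.2)) a.1 else α a := by
  have H1 := reaches_swapStep p 0 H (h' := fun a => if isChild p 0 a.1 then
    (⟨a.1 / 2, by omega⟩, false) else (a.1, false)) fun a => by
      by_cases h : isChild p 0 a.1 = true
      · simp [h, vertexCopy, childSwap_of_isChild (k := 0) h]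
      · simp [h, vertexCopy]
  have H2 := reaches_swapStep p 1 H1 (h' := fun a => (endpoint p a.1, false)) fun a => by
      by_cases h : isChild p 1 a.1 = true
      · simp [h, not_isChild_zero h, endpoint_eq, childSwap_of_isChild (k := 1) h]
      · by_cases h0 : isChild p 0 a.1 = true <;> simp [h, h0, endpoint_eq]
  have H3 := reaches_localStep (controlledReflection p t) H2 fun a a' ha => by
    obtain ⟨v, j⟩ := a
    obtain ⟨v', j'⟩ := a'
    simp only [controlledReflection, Matrix.blockDiagonal_apply] at ha
    obtain ⟨-, ha⟩ := ite_ne_right_iff.1 ha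
    simp only [Prod.mk.injEq, and_true]
    split_ifs at ha
    · exact fiberReflection_ne_zero ha
    · rw [not_imp_comm.1 (fun hne => Matrix.one_apply_ne hne) ha]
  have H4 := reaches_swapStep p 0 H3 (h' := fun a => if isChild p 1 a.1 then
    (⟨a.1 / 2, by omega⟩, false) else (a.1, false)) fun a => by
      by_cases h : isChild p 0 a.1 = true
      · have h1 : isChild p 1 a.1 = false := by
          by_contra h1
          simp [not_isChild_zero (by simpa using h1)] at h
        simp [h, h1, endpoint_eq, childSwap_half (k := 0) h]
      · by_cases h1 : isChild p 1 a.1 = true <;> simp [h, h1, endpoint_eq]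
  have H5 := reaches_swapStep p 1 H4 (h' := vertexCopy) fun a => by
      by_cases h : isChild p 1 a.1 = true
      · simp [h, vertexCopy, childSwap_half (k := 1) h]
      · simp [h, vertexCopy]
  simp only [List.append_assoc, List.cons_append, List.nil_append] at H5
  rw [halfRound]
  convert H5 using 1
  funext ⟨v, j⟩
  simp only [controlledReflection, blockDiagonal_mulVec]
  split_ifs
  · rfl
  · simp

theorem reaches_walkRound (t : ℕ) (H : Reaches x y a₀ b₀ l vertexCopy α) :
    Reaches x y a₀ b₀ (l ++ walkRound t) vertexCopy fun a =>
      if t < (a.2 : ℕ) then (walk x y).mulVec (fun v => α (v, a.2)) a.1 else α a := by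
  have H1 := (reaches_halfRound false t H).snoc (markStep t) (h' := vertexCopy)
    (α' := fun a => if t < (a.2 : ℕ) then (markMatrix x y).mulVec
      ((reflection n false).mulVec (fun v => α (v, a.2))) a.1 else α a)
    (fun a a' ha => by rw [not_imp_comm.1 (fun hne => Matrix.one_apply_ne hne) ha])
    (fun a => by simp [markStep]) (fun a => by
      by_cases h : t < (a.2 : ℕ)
      · simp [markStep, h, markMatrix, Matrix.mulVec_diagonal, vertexCopy]
      · simp [markStep, h])
  have H2 := reaches_halfRound true t H1
  simp only [List.append_assoc, List.cons_append, List.nil_append] at H2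
  rw [walkRound]
  convert H2 using 1
  funext ⟨v, j⟩
  by_cases h : t < (j : ℕ)
  · simp only [h, if_true, walk, ← Matrix.mulVec_mulVec]
  · simp only [h, if_false]

/-- Round `t` acts only where the counter exceeds `t`, so counter value `j` receives exactly `j`
applications once `t ≥ j`. -/
theorem reaches_walkRounds {e : Fin (2 * n) → ℂ} {c : ℂ}
    (H : Reaches x y a₀ b₀ l vertexCopy fun a => c * e a.1) (t : ℕ) :
    Reaches x y a₀ b₀ (l ++ walkRounds t) vertexCopy fun a =>
      c * ((walk x y) ^ min t (a.2 : ℕ)).mulVec e a.1 := by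
  induction t with
  | zero => simpa [walkRounds] using H
  | succ t ih =>
    have H1 := reaches_walkRound t ih
    rw [List.append_assoc] at H1
    rw [walkRounds]
    convert H1 using 1
    funext ⟨v, j⟩
    by_cases h : t < (j : ℕ)
    · simp only [h, if_true]
      rw [min_eq_left h, min_eq_left h.le, pow_succ', ← Matrix.mulVec_mulVec]
      change _ = (walk x y).mulVec (c • _) v
      rw [Matrix.mulVec_smul]
      rfl
    · simp only [h, if_false]
      rw [min_eq_right (by omega), min_eq_right (by omega)]

theorem counterReflection_apply (j₀ : Fin M) (v v' : Fin (2 * n)) (j j' : Fin M) :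
    (counterReflection (n := n) j₀ : Matrix (Fin (2 * n) × Fin M) (Fin (2 * n) × Fin M) ℂ) (v, j) (v', j') =
      if v = v' then uniformReflection j₀ j j' else 0 := by
  simp [counterReflection, Matrix.blockDiagonal_apply]

theorem counterReflection_mulVec (j₀ : Fin M) (v : Fin (2 * n)) (j : Fin M) :
    (counterReflection (n := n) j₀ : Matrix (Fin (2 * n) × Fin M) (Fin (2 * n) × Fin M) ℂ).mulVec α (v, j) =
      ∑ j', uniformReflection j₀ j j' * α (v, j') := by
  simp only [Matrix.mulVec, dotProduct, Fintype.sum_prod_type, counterReflection_apply]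
  rw [Finset.sum_eq_single v] <;> simp +contextual [eq_comm]

theorem reaches_counterReflection (j₀ : Fin M) (H : Reaches x y a₀ b₀ l vertexCopy α) :
    Reaches x y a₀ b₀ (l ++ [localStep (counterReflection j₀)]) vertexCopy fun a =>
      ∑ j, uniformReflection j₀ a.2 j * α (a.1, j) := by
  convert reaches_localStep (counterReflection j₀) H fun a a' ha => ?_ using 1
  · funext ⟨v, j⟩
    rw [counterReflection_mulVec]
  · obtain ⟨v, j⟩ := a
    obtain ⟨v', j'⟩ := a'
    rw [counterReflection_apply] at ha
    rw [vertexCopy, vertexCopy, (ite_ne_right_iff.1 ha).1]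

/-- All steps of the protocol. -/
noncomputable def allSteps (j₀ : Fin M) : List (Step n M) :=
  [localStep (counterReflection j₀)] ++ walkRounds M ++ [localStep (counterReflection j₀)] ++
    [storeStep j₀]

theorem length_allSteps (j₀ : Fin M) : (allSteps j₀ : List (Step n M)).length = 11 * M + 3 := by
  simp [allSteps, length_walkRounds]

/-- Preparing and undoing the uniform superposition each contribute a factor `1 / √M`, which gives
the weight `1 / M` of the average. The last step lets Bob know the outcome. -/
theorem exists_reaches_allSteps (hn : n ≠ 0) (hM : 1 < M) (x y : Fin n → Bool) (j₀ : Fin M) :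
    ∃ α : Fin (2 * n) × Fin M → ℂ,
      Reaches x y (root hn, j₀) (root hn, false) (allSteps j₀)
        (fun a => (a.1, decide (a.2 = j₀))) α ∧
      ∀ v, α (v, j₀) = iterateAverage (walk x y) (Pi.single (root hn) 1) M v := by
  have hc : 1 < Fintype.card (Fin M) := by simpa using hM
  have H0 := reaches_counterReflection (x := x) (y := y) j₀
    (Reaches.nil (a₀ := (root hn, j₀)) (b₀ := (root hn, false)) vertexCopy rfl)
  have e0 : (fun a : Fin (2 * n) × Fin M => ∑ j, uniformReflection j₀ a.2 j *
      (Pi.single (root hn, j₀) 1 : Fin (2 * n) × Fin M → ℂ) (a.1, j)) =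
      fun a => ((1 / √M : ℝ) : ℂ) * (Pi.single (root hn) 1 : Fin (2 * n) → ℂ) a.1 := by
    funext ⟨v, j⟩
    rw [Finset.sum_eq_single j₀]
    · rw [uniformReflection_apply j₀ hc (Or.inr rfl), Fintype.card_fin]
      simp [Pi.single_apply]
    · intro j' _ hj
      simp [hj]
    · simp
  rw [e0, List.nil_append] at H0
  have H1 := reaches_counterReflection j₀ (reaches_walkRounds H0 M)
  refine ⟨_, H1.snoc (storeStep j₀) (fun a a' ha => ?_) (fun a => ?_) fun a => rfl, fun v => ?_⟩
  · rw [not_imp_comm.1 (fun hne => Matrix.one_apply_ne hne) ha]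
  · by_cases h : a.2 = j₀ <;> simp [storeStep, h, vertexCopy]
  · simp only [storeStep, Bool.and_false, Bool.false_eq_true, if_false, one_mul,
      OneMemClass.coe_one, Matrix.one_mulVec]
    rw [iterateAverage, Pi.smul_apply, Finset.sum_apply, smul_eq_mul, Finset.mul_sum,
      ← Fin.sum_univ_eq_sum_range
        (fun j => (1 / M : ℂ) * ((walk x y) ^ j).mulVec (Pi.single (root hn) 1) v)]
    refine Finset.sum_congr rfl fun j _ => ?_
    rw [uniformReflection_apply j₀ hc (Or.inl rfl), Fintype.card_fin, min_eq_right j.2.le,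
      ← mul_assoc, ← Complex.ofReal_mul, div_mul_div_comm, Real.mul_self_sqrt (by positivity)]
    simp

/-- The protocol for disjointness. -/
noncomputable def protocol (hn : n ≠ 0) (j₀ : Fin M) :
    QuantumProtocol (Fin n → Bool) (Fin n → Bool) :=
  toProtocol (allSteps j₀) (root hn, j₀) (root hn, false) (fun a => decide (a.2 = j₀)) (·.2)

theorem protocol_computes (hn : n ≠ 0) (hM : 1 < M) (hnM : 99 * n ≤ M ^ 2) (j₀ : Fin M) :
    (protocol hn j₀).Computes (disjointness n) := by
  intro x y
  obtain ⟨α, H, hα⟩ := exists_reaches_allSteps hn hM x y j₀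
  have hprob := H.probOutput_eq (List.length_pos_iff.1 (by rw [length_allSteps]; omega))
    (outA := fun a => decide (a.2 = j₀)) (outB := (·.2)) fun a => rfl
  rw [protocol, hprob]
  have htrue : (∑ a, if decide (a.2 = j₀) = true then ‖α a‖ ^ 2 else 0) =
      normSum (iterateAverage (walk x y) (Pi.single (root hn) 1) M) := by
    simp [Fintype.sum_prod_type, hα, normSum]
  have hM0 : 0 < M := by omega
  by_cases h : ∃ i, x i = true ∧ y i = true
  · obtain ⟨i, hx, hy⟩ := h
    rw [show disjointness n x y = true from decide_eq_true ⟨i, hx, hy⟩, htrue]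
    have h1 := one_le_normSum_iterateAverage (walk_mem x y) (walk_potential hx hy)
      (e := Pi.single (root hn) 1) (by
        simp [root, potential_root n (m := n + i) (by omega)]) hM0
    have h2 := normSum_potential_le (n := n) (m := n + i) (by omega)
    have h3 : 0 ≤ normSum (iterateAverage (walk x y) (Pi.single (root hn) 1) M) :=
      Finset.sum_nonneg fun _ _ => by positivity
    -- The product of the two squared norms is at least 1 and the first is at most `3 / 2`, so the
    -- second is at least `2 / 3`.
    nlinarith
  · rw [show disjointness n x y = false from decide_eq_false h]
    have hsum : (∑ a, if decide (a.2 = j₀) = false then ‖α a‖ ^ 2 else 0) +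
        (∑ a, if decide (a.2 = j₀) = true then ‖α a‖ ^ 2 else 0) = 1 := by
      rw [← Finset.sum_add_distrib, ← H.normSum_eq]
      refine Finset.sum_congr rfl fun a _ => ?_
      by_cases ha : a.2 = j₀ <;> simp [ha]
    rw [htrue] at hsum
    have h1 := normSum_iterateAverage_le (walk_mem x y)
      (two_smul_root_eq hn (x := x) (y := y) (fun i hi => h ⟨i, hi⟩)) M
    have h2 := normSum_amplitude_le n
    have hM' : (99 * n : ℝ) ≤ (M : ℝ) ^ 2 := by exact_mod_cast hnM
    have hn1 : (1 : ℝ) ≤ n := by exact_mod_cast Nat.one_le_iff_ne_zero.2 hn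
    -- This is `1 + 32 n ≤ 33 n ≤ M² / 3`, the origin of the constant 99.
    have h3 : normSum (fun v : Fin (2 * n) => (amplitude n v : ℂ)) / (M : ℝ) ^ 2 ≤ 1 / 3 := by
      rw [div_le_iff₀ (by positivity)]
      linarith
    linarith

end HeapTree

/-! ### The bound on the cost. -/

theorem mainTheorem3 :
    ∃ C : ℝ, 0 < C ∧ ∀ n : ℕ, 1 ≤ n →
      ((quantumCommComplexity (disjointness n) : ℕ∞) : ℝ≥0∞) ≤
        ENNReal.ofReal (C * Real.sqrt n) := by
  -- The cost is `2 (11 M + 3) - 1 = 22 M + 5`, and `M ≤ 10 (√n + 1)` gives `220 √n + 225 ≤ 445 √n`.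
  -- The factor 10 in `M` ensures `99 n ≤ M²`.
  refine ⟨445, by norm_num, fun n hn => ?_⟩
  set M := 10 * (Nat.sqrt n + 1) with hM
  have hn0 : n ≠ 0 := by omega
  let P := HeapTree.protocol hn0 (⟨0, by omega⟩ : Fin M)
  have hP : P.Computes (disjointness n) := by
    refine HeapTree.protocol_computes hn0 (by omega) ?_ _
    have := Nat.lt_succ_sqrt n
    rw [hM]
    nlinarith
  have hcost : P.cost = 22 * M + 5 := by
    change 2 * (HeapTree.allSteps (⟨0, by omega⟩ : Fin M)).length - 1 = _
    rw [HeapTree.length_allSteps]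
    omega
  have h1 : quantumCommComplexity (disjointness n) ≤ (P.cost : ℕ∞) := iInf₂_le P hP
  calc ((quantumCommComplexity (disjointness n) : ℕ∞) : ℝ≥0∞)
      ≤ ((P.cost : ℕ∞) : ℝ≥0∞) := by exact_mod_cast h1
    _ = ENNReal.ofReal (P.cost : ℝ) := by simp
    _ ≤ _ := by
      refine ENNReal.ofReal_le_ofReal ?_
      have h2 : (Nat.sqrt n : ℝ) ≤ √n := Real.nat_sqrt_le_real_sqrt
      have h3 : (1 : ℝ) ≤ √n := Real.one_le_sqrt.2 (by exact_mod_cast hn)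
      rw [hcost, hM]
      push_cast
      linarith
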